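/- Let $\mathcal L$ be a (single-sorted, metric) continuous signature: a set of function symbols and predicate symbols with finite arities, a distinguished binary distance symbol $d$, and for every symbol $s$ and argument position $i$ a continuity modulus $\delta_{s,i}\colon(0,\infty)\to(0,\infty)$. An $\mathcal L$-structure is a set $M$ with functions $f^M\colon M^n\to M$ and predicates $P^M\colon M^n\to[0,1]$ such that $d^M$ is a complete metric and each symbol $s$ respects $\delta_{s,i}$ in its $i$-th argument (if $d^M(z,w)<\delta_{s,i}(\varepsilon)$, then changing the $i$-th argument from $z$ to $w$ changes the value of $s^M$ by at most $\varepsilon$). Fix a full system of continuous connectives, that is, sets $F_n$ of continuous functions $[0,1]^n\to[0,1]$ such that for every $n>0$ the $n$-ary functions obtained from them and the coordinate projections by composition are uniformly dense in $C([0,1]^n,[0,1])$. Formulae are built from atomic formulae $P(\tau_1,\dots,\tau_m)$ by these connectives and the quantifiers $\inf_x$ and $\sup_x$, and $\varphi^M(\bar a)\in[0,1]$ is the value of $\varphi$ at $\bar a$ in $M$. A theory $T$ (not necessarily complete or satisfiable) is a set of conditions $\varphi=0$ with $\varphi$ a sentence, and $M\models T$ if $\varphi^M=0$ for each of these. Say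 that: * $T$ has quantifier elimination if for every formula $\varphi(x_0,\dots,x_{n-1})$ and every $\varepsilon>0$ there is a quantifier-free formula $\psi(x_0,\dots,x_{n-1})$ with $|\varphi^M(\bar a)-\psi^M(\bar a)|\le\varepsilon$ for all $M\models T$ and $\bar a\in M^n$; if $n=0$, $\psi$ is allowed to have one free variable $x_0$, and the inequality is $|\varphi^M-\psi^M(a)|\le\varepsilon$ for all $M\models T$ and $a\in M$. * A structure $M$ is $\omega$-saturated if every $1$-type over a finite tuple of $M$ is realised in $M$. That is, whenever $\bar a\in M^n$, $N$ is an $\mathcal L$-structure, $\bar b\in N^n$ satisfies $\varphi^M(\bar a)=\varphi^N(\bar b)$ for all formulae $\varphi$, and $c\in N$, there is $c'\in M$ with $\varphi^M(\bar a,c')=\varphi^N(\bar b,c)$ for all formulae $\varphi$. * $T$ has the back-and-forth property if for any two $\omega$-saturated models $M,N\models T$, every $n\ge1$, $\bar a\in M^n$, $\bar b\in N^n$ and $c\in M$: if $\varphi^M(\bar a)=\varphi^N(\bar b)$ for all quantifier-free $\varphi$, then there is $d\in N$ with $\varphi^M(\bar a,c)=\varphi^N(\bar b,d)$ for all quantifier-free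 $\varphi$. Then $T$ has quantifier elimination if and only if $T$ has the back-and-forth property. -/

import Mathlib

universe u v w

/-- A system of continuous connectives: for each `n`, a set of continuous functions
`[0,1]ⁿ → [0,1]`. -/
def ConnectiveSystem : Type :=
  ∀ n : ℕ, Set C(Fin n → unitInterval, unitInterval)

namespace ConnectiveSystem

/-- The closed system generated by `F`: it contains `F`, the projections, and is closed under
composition. -/
inductive Closure (F : ConnectiveSystem) :
    ∀ n : ℕ, C(Fin n → unitInterval, unitInterval) → Prop
  | of {n : ℕ} (f : C(Fin n → unitInterval, unitInterval)) (hf : f ∈ F n) : Closure F n f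
  | proj {n : ℕ} (i : Fin n) : Closure F n ⟨fun x => x i, continuous_apply i⟩
  | comp {n m : ℕ} (f : C(Fin n → unitInterval, unitInterval))
      (g : Fin n → C(Fin m → unitInterval, unitInterval))
      (hf : Closure F n f) (hg : ∀ i, Closure F m (g i)) :
      Closure F m (f.comp (ContinuousMap.pi g))

/-- `F` is full: for every `n > 0` the `n`-ary functions of the closed system generated by `F`
are dense in `C([0,1]ⁿ, [0,1])` for uniform convergence. -/
def IsFull (F : ConnectiveSystem) : Prop :=
  ∀ n : ℕ, 0 < n → Dense {f : C(Fin n → unitInterval, unitInterval) | Closure F n f}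

end ConnectiveSystem

/-- A (metric) continuous signature: function and predicate symbols with arities (a Mathlib
first-order language, whose `Relations n` are read as the `n`-ary predicate symbols), a
distinguished binary distance symbol, and for every symbol and every argument position
a continuity modulus `(0,∞) → (0,∞)`. -/
structure ContSignature extends FirstOrder.Language.{u, v} where
  /-- the distance symbol -/
  distSymb : toLanguage.Relations 2
  /-- continuity moduli of function symbols -/
  funModulus : ∀ {n : ℕ}, toLanguage.Functions n → Fin n →
    Set.Ioi (0 : ℝ) → Set.Ioi (0 : ℝ)
  /-- continuity moduli of predicate symbols -/
  predModulus : ∀ {n : ℕ}, toLanguage.Relations n → Fin n →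
    Set.Ioi (0 : ℝ) → Set.Ioi (0 : ℝ)

/-- A continuous pre-structure on `M`: interpretations of the symbols satisfying the
pseudo-metric axioms and the uniform continuity axioms. -/
class ContPreStructure (S : ContSignature.{u, v}) (M : Type w) where
  /-- interpretation of function symbols -/
  funMap : ∀ {n : ℕ}, S.Functions n → (Fin n → M) → M
  /-- interpretation of predicate symbols -/
  predMap : ∀ {n : ℕ}, S.Relations n → (Fin n → M) → unitInterval
  d_self : ∀ x : M, (predMap S.distSymb ![x, x] : ℝ) = 0
  d_comm : ∀ x y : M,
    (predMap S.distSymb ![x, y] : ℝ) = predMap S.distSymb ![y, x]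
  d_triangle : ∀ x y z : M,
    (predMap S.distSymb ![x, y] : ℝ)
      ≤ predMap S.distSymb ![x, z] + predMap S.distSymb ![z, y]
  funMap_uc : ∀ {n : ℕ} (f : S.Functions n) (i : Fin n) (ε : Set.Ioi (0 : ℝ))
    (a : Fin n → M) (z w : M),
    (predMap S.distSymb ![z, w] : ℝ) < S.funModulus f i ε →
      (predMap S.distSymb
        ![funMap f (Function.update a i z), funMap f (Function.update a i w)] : ℝ) ≤ ε
  predMap_uc : ∀ {n : ℕ} (P : S.Relations n) (i : Fin n) (ε : Set.Ioi (0 : ℝ))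
    (a : Fin n → M) (z w : M),
    (predMap S.distSymb ![z, w] : ℝ) < S.predModulus P i ε →
      (predMap P (Function.update a i z) : ℝ) - predMap P (Function.update a i w) ≤ ε

/-- The interpretation of the distance symbol, as a real number. -/
def contDist (S : ContSignature.{u, v}) {M : Type w} [ContPreStructure S M] (x y : M) : ℝ :=
  ContPreStructure.predMap S.distSymb ![x, y]

/-- A continuous structure: a pre-structure whose distance is a complete metric. -/
class ContStructure (S : ContSignature.{u, v}) (M : Type w) extends ContPreStructure S M where
  eq_of_dist_eq_zero : ∀ x y : M, contDist S x y = 0 → x = y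
  complete : ∀ s : ℕ → M,
    (∀ ε : ℝ, 0 < ε → ∃ N : ℕ, ∀ m ≥ N, ∀ n ≥ N, contDist S (s m) (s n) < ε) →
      ∃ x : M, ∀ ε : ℝ, 0 < ε → ∃ N : ℕ, ∀ n ≥ N, contDist S (s n) x < ε

/-- The interpretation `τ^M(a)` of a term `τ(x₀,…,x_{n-1})` at a tuple `a ∈ Mⁿ`. -/
def termValue {S : ContSignature.{u, v}} {M : Type w} [ContPreStructure S M] {n : ℕ}
    (a : Fin n → M) : S.Term (Fin n) → M
  | .var i => a i
  | .func f t => ContPreStructure.funMap f fun i => termValue a (t i)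

/-- `ContFormula S F n`: continuous first order formulae `φ(x₀,…,x_{n-1})` over `S`, with
connectives from `F`. In the quantifier cases the bound variable is the last one, `x_n`. -/
inductive ContFormula (S : ContSignature.{u, v}) (F : ConnectiveSystem) :
    ℕ → Type (max u v)
  | atomic {n m : ℕ} (P : S.Relations m) (t : Fin m → S.Term (Fin n)) : ContFormula S F n
  | conn {n m : ℕ} (c : F m) (φ : Fin m → ContFormula S F n) : ContFormula S F n
  | inf {n : ℕ} (φ : ContFormula S F (n + 1)) : ContFormula S F n
  | sup {n : ℕ} (φ : ContFormula S F (n + 1)) : ContFormula S F n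

namespace ContFormula

variable {S : ContSignature.{u, v}} {F : ConnectiveSystem}

/-- The formula contains no quantifier. -/
def IsQF : ∀ {n : ℕ}, ContFormula S F n → Prop
  | _, atomic _ _ => True
  | _, conn _ φ => ∀ i, (φ i).IsQF
  | _, inf _ => False
  | _, sup _ => False

/-- The truth value `φ^M(a) ∈ [0,1]` of `φ(x₀,…,x_{n-1})` at a tuple `a ∈ Mⁿ`. Infima and
suprema are taken in the complete lattice `[0,1]`. -/
noncomputable def value {M : Type w} [ContPreStructure S M] :
    ∀ {n : ℕ}, ContFormula S F n → (Fin n → M) → unitInterval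
  | _, atomic P t, a => ContPreStructure.predMap P fun i => termValue a (t i)
  | _, conn c φ, a => c.1 fun i => (φ i).value a
  | _, inf φ, a => ⨅ b : M, φ.value (Fin.snoc a b)
  | _, sup φ, a => ⨆ b : M, φ.value (Fin.snoc a b)

end ContFormula

/-- A continuous theory: a set of sentences `φ`, standing for the conditions `φ = 0`. -/
def ContTheory (S : ContSignature.{u, v}) (F : ConnectiveSystem) : Type (max u v) :=
  Set (ContFormula S F 0)

section

variable {S : ContSignature.{u, v}} (F : ConnectiveSystem)

/-- `tp^M(a) = tp^N(b)`: all formulae take the same value at `a` and at `b`. -/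
def SameType {M N : Type w} [ContPreStructure S M] [ContPreStructure S N] {n : ℕ}
    (a : Fin n → M) (b : Fin n → N) : Prop :=
  ∀ φ : ContFormula S F n, φ.value a = φ.value b

/-- `a` and `b` have the same quantifier-free type. -/
def SameQFType {M N : Type w} [ContPreStructure S M] [ContPreStructure S N] {n : ℕ}
    (a : Fin n → M) (b : Fin n → N) : Prop :=
  ∀ φ : ContFormula S F n, φ.IsQF → φ.value a = φ.value b

/-- `M` is `ω`-saturated: every `1`-type over a finite tuple `a` of `M` is realised in `M`.
The `1`-types over `a` are those of the elements `c` of the structures `N` in which some tuple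
`b` satisfies `(N, b) ≡ (M, a)`; so this says that every such `c` has a copy `c'` in `M`. -/
def IsOmegaSaturated (S : ContSignature.{u, v}) (F : ConnectiveSystem)
    (M : Type (max u v w)) [ContStructure S M] : Prop :=
  ∀ (n : ℕ) (a : Fin n → M) (N : Type (max u v w)) [ContStructure S N] (b : Fin n → N),
    SameType (S := S) F a b → ∀ c : N, ∃ c' : M,
      SameType (S := S) F (Fin.snoc a c' : Fin (n + 1) → M) (Fin.snoc b c : Fin (n + 1) → N)

end

namespace ContTheory

variable {S : ContSignature.{u, v}} {F : ConnectiveSystem}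

/-- `M ⊨ T`. -/
def IsModel (T : ContTheory S F) (M : Type w) [ContStructure S M] : Prop :=
  ∀ φ ∈ (show Set (ContFormula S F 0) from T), φ.value (Fin.elim0 : Fin 0 → M) = 0

/-- `T` has quantifier elimination: every formula `φ(x₀,…,x_{n-1})` can be approximated
uniformly over all models of `T` by quantifier-free formulae in the same variables, where for
a sentence `φ` the quantifier-free formula may have one free variable. -/
def HasQE (T : ContTheory S F) : Prop :=
  ∀ (n : ℕ) (φ : ContFormula S F n) (ε : ℝ), 0 < ε →
    ∃ ψ : ContFormula S F (max n 1), ψ.IsQF ∧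
      ∀ (M : Type (max u v w)) [ContStructure S M], T.IsModel M →
        ∀ a : Fin (max n 1) → M,
          |(φ.value (fun i => a (Fin.castLE (le_max_left n 1) i)) : ℝ) - ψ.value a| ≤ ε

/-- The back-and-forth property between `ω`-saturated models of `T`. -/
def HasBackAndForth (T : ContTheory S F) : Prop :=
  ∀ (M N : Type (max u v w)) [ContStructure S M] [ContStructure S N],
    IsOmegaSaturated.{u, v, w} S F M → IsOmegaSaturated.{u, v, w} S F N →
    T.IsModel M → T.IsModel N →
    ∀ (n : ℕ), 0 < n → ∀ (a : Fin n → M) (b : Fin n → N) (c : M),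
      SameQFType (S := S) F a b → ∃ d : N,
        SameQFType (S := S) F (Fin.snoc a c : Fin (n + 1) → M) (Fin.snoc b d : Fin (n + 1) → N)

end ContTheory

-- Quantifier elimination gives back-and-forth at once: letting the error tend to 0, nonempty tuples
-- with equal quantifier-free types have equal types, and `ω`-saturation of the second model
-- supplies the required element.
--
-- Conversely, between `ω`-saturated models back-and-forth lets an equality of quantifier-free types
-- follow the quantifiers of a formula, so by induction the quantifier-free type determines every
-- value (`ContTheory.HasBackAndForth.value_eq`). Compactness makes this uniform
-- (`ContTheory.HasBackAndForth.exists_finset`): otherwise, for each finite set of quantifier-free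
-- formulae and each tolerance, two tuples in models of `T` nearly agree on that set but differ on
-- `φ` by at least `ε`. Saturated limits of these pairs along an ultrafilter have equal
-- quantifier-free types and different values of `φ`, a contradiction. Hence `φ` is nearly a
-- continuous function of finitely many quantifier-free formulae (`exists_continuousMap_near`), and
-- fullness turns this function into a formula.
--
-- The main work is `exists_saturatedLimit`. The signature may be large, so an arbitrary
-- ultraproduct need not be saturated. Instead there is a formal name for a witness to each set of
-- conditions over countably many names. Zorn's lemma gives a maximal assignment of limit values
-- that is approximated by models of `T`; by maximality every approximately satisfiable set of
-- conditions is realised by its own witness. This one property yields values of function symbols,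
-- attained infima and suprema (hence a Łoś theorem), completeness and saturation. Countably many
-- parameters are allowed in order to reach limits of Cauchy sequences.

universe t
open Filter Topology

/-! ### Continuous combinations and renaming of variables -/

namespace ContFormula

variable {S : ContSignature.{u, v}} {F : ConnectiveSystem}

/-- Every function of the closed system generated by `F` acts on formulae. -/
theorem exists_value_eq_of_closure {n : ℕ} {c : C(Fin n → unitInterval, unitInterval)}
    (hc : F.Closure n c) {m : ℕ} (φ : Fin n → ContFormula S F m) :
    ∃ ψ : ContFormula S F m, ((∀ i, (φ i).IsQF) → ψ.IsQF) ∧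
      ∀ (M : Type w) [ContPreStructure S M] (a : Fin m → M),
        ψ.value a = c fun i => (φ i).value a := by
  induction hc generalizing m with
  | of f hf => exact ⟨conn ⟨f, hf⟩ φ, fun h => h, fun M _ a => rfl⟩
  | proj i => exact ⟨φ i, fun h => h i, fun M _ a => rfl⟩
  | comp f g _ _ ihf ihg =>
    choose χ hχ hval using fun i => ihg i φ
    obtain ⟨ψ, hψ, hψval⟩ := ihf χ
    refine ⟨ψ, fun h => hψ fun i => hχ i h, fun M _ a => ?_⟩
    rw [hψval]
    simp only [hval]
    rfl

/-- Over a full system, every continuous combination of formulae is approximated by formulae. -/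
theorem exists_value_near (hF : F.IsFull) {n : ℕ} (hn : 0 < n)
    (h : C(Fin n → unitInterval, unitInterval)) {ε : ℝ} (hε : 0 < ε) {m : ℕ}
    (φ : Fin n → ContFormula S F m) :
    ∃ ψ : ContFormula S F m, ((∀ i, (φ i).IsQF) → ψ.IsQF) ∧
      ∀ (M : Type w) [ContPreStructure S M] (a : Fin m → M),
        dist (ψ.value a) (h fun i => (φ i).value a) < ε := by
  obtain ⟨c, hc, hd⟩ := (hF n hn).exists_dist_lt h hε
  obtain ⟨ψ, hψ, hval⟩ := exists_value_eq_of_closure.{u, v, w} hc φ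
  refine ⟨ψ, hψ, fun M _ a => ?_⟩
  rw [hval, dist_comm]
  exact (ContinuousMap.dist_apply_le_dist _).trans_lt hd

/-- Renaming the free variables of a formula. -/
def relabel : ∀ {n m : ℕ}, (Fin n → Fin m) → ContFormula S F n → ContFormula S F m
  | _, _, g, atomic P t => atomic P fun i => (t i).relabel g
  | _, _, g, conn c φ => conn c fun i => (φ i).relabel g
  | _, m, g, inf φ => inf (φ.relabel (Fin.snoc (Fin.castSucc ∘ g) (Fin.last m)))
  | _, m, g, sup φ => sup (φ.relabel (Fin.snoc (Fin.castSucc ∘ g) (Fin.last m)))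

theorem _root_.termValue_relabel {M : Type w} [ContPreStructure S M] {n m : ℕ}
    (g : Fin n → Fin m) (t : S.Term (Fin n)) (a : Fin m → M) :
    termValue a (t.relabel g) = termValue (a ∘ g) t := by
  induction t with
  | var i => rfl
  | func f t ih =>
    simp only [FirstOrder.Language.Term.relabel, termValue]
    congr 1
    funext i
    exact ih i

theorem _root_.Fin.snoc_comp_snoc_castSucc {M : Type w} {n m : ℕ} (g : Fin n → Fin m)
    (a : Fin m → M) (b : M) :
    (Fin.snoc a b : Fin (m + 1) → M) ∘
        (Fin.snoc (Fin.castSucc ∘ g) (Fin.last m) : Fin (n + 1) → Fin (m + 1)) =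
      Fin.snoc (a ∘ g) b := by
  funext i
  refine Fin.lastCases ?_ (fun j => ?_) i <;> simp

theorem value_relabel {M : Type w} [ContPreStructure S M] {n m : ℕ} (g : Fin n → Fin m)
    (φ : ContFormula S F n) (a : Fin m → M) : (φ.relabel g).value a = φ.value (a ∘ g) := by
  induction φ generalizing m with
  | atomic P t => simp only [relabel, value, termValue_relabel]
  | conn c φ ih => simp only [relabel, value, ih]
  | inf φ ih => simp only [relabel, value, ih, Fin.snoc_comp_snoc_castSucc]
  | sup φ ih => simp only [relabel, value, ih, Fin.snoc_comp_snoc_castSucc]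

end ContFormula

/-! ### Uniform continuity of symbols, with moduli independent of the structure -/

section UniformContinuity

variable {S : ContSignature.{u, v}}

theorem contDist_self {M : Type w} [ContPreStructure S M] (x : M) : contDist S x x = 0 :=
  ContPreStructure.d_self x

theorem contDist_comm {M : Type w} [ContPreStructure S M] (x y : M) :
    contDist S x y = contDist S y x :=
  ContPreStructure.d_comm x y

theorem contDist_triangle {M : Type w} [ContPreStructure S M] (x y z : M) :
    contDist S x y ≤ contDist S x z + contDist S z y :=
  ContPreStructure.d_triangle x y z

theorem contDist_nonneg {M : Type w} [ContPreStructure S M] (x y : M) : 0 ≤ contDist S x y :=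
  (ContPreStructure.predMap S.distSymb ![x, y]).2.1

/-- A pseudodistance on tuples which is small when one coordinate is changed is controlled
when all coordinates are changed. -/
theorem le_mul_of_update_le {M : Type w} {m : ℕ} (e : (Fin m → M) → (Fin m → M) → ℝ)
    (he : ∀ a, e a a = 0) (htri : ∀ a b c, e a b ≤ e a c + e c b) (x y : Fin m → M) {η : ℝ}
    (h : ∀ k a, e (Function.update a k (x k)) (Function.update a k (y k)) ≤ η) :
    e x y ≤ m * η := by
  have key : ∀ k : ℕ, k ≤ m → e x (fun i => if i.val < k then y i else x i) ≤ k * η := by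
    intro k
    induction k with
    | zero => intro _; simp [he]
    | succ k ih =>
      intro hk
      set z : Fin m → M := fun i => if i.val < k then y i else x i with hz
      have h1 : Function.update z ⟨k, hk⟩ (x ⟨k, hk⟩) = z := by
        rw [Function.update_eq_self_iff]
        simp [hz]
      have h2 : Function.update z ⟨k, hk⟩ (y ⟨k, hk⟩) =
          fun i => if i.val < k + 1 then y i else x i := by
        funext i
        by_cases hi : i = ⟨k, hk⟩
        · subst hi; simp
        · have : i.val ≠ k := fun h => hi (Fin.ext h)
          rw [Function.update_of_ne hi]
          by_cases h' : i.val < k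
          · simp [hz, h', h'.trans (Nat.lt_succ_self k)]
          · have : ¬ i.val < k + 1 := by omega
            simp [hz, h', this]
      have h3 := h ⟨k, hk⟩ z
      rw [h1, h2] at h3
      have h4 := htri x (fun i => if i.val < k + 1 then y i else x i) z
      have h5 := ih (by omega)
      push_cast
      linarith
  have := key m le_rfl
  simpa using this

theorem predMap_uniformContinuous {m : ℕ} (P : S.Relations m) {ε : ℝ} (hε : 0 < ε) :
    ∃ δ : ℝ, 0 < δ ∧ ∀ (M : Type w) [ContPreStructure S M] (x y : Fin m → M),
      (∀ k, contDist S (x k) (y k) < δ) →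
        |(ContPreStructure.predMap P x : ℝ) - ContPreStructure.predMap P y| ≤ ε := by
  -- Changing the `m` coordinates one at a time costs at most `m * (ε / (m + 1)) ≤ ε`; the `+ 1`
  -- covers arity 0.
  have hη : 0 < ε / (m + 1) := by positivity
  obtain ⟨δ, hδ⟩ := Finite.exists_ge fun k => S.predModulus P k ⟨ε / (m + 1), hη⟩
  refine ⟨δ, δ.2, fun M _ x y hxy => ?_⟩
  have := le_mul_of_update_le
    (fun a b => |(ContPreStructure.predMap P a : ℝ) - ContPreStructure.predMap P b|)
    (fun a => by simp) (fun a b c => abs_sub_le _ _ _) x y (η := ε / (m + 1)) (fun k a => by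
      refine abs_sub_le_iff.2 ⟨?_, ?_⟩
      · exact ContPreStructure.predMap_uc P k ⟨_, hη⟩ a _ _
          ((hxy k).trans_le (Subtype.coe_le_coe.2 (hδ k)))
      · refine ContPreStructure.predMap_uc P k ⟨_, hη⟩ a _ _ (lt_of_lt_of_le ?_
          (Subtype.coe_le_coe.2 (hδ k)))
        have := hxy k
        rwa [contDist_comm] at this)
  refine this.trans ?_
  rw [← mul_div_assoc, div_le_iff₀ (by positivity)]
  nlinarith

theorem funMap_uniformContinuous {m : ℕ} (f : S.Functions m) {ε : ℝ} (hε : 0 < ε) :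
    ∃ δ : ℝ, 0 < δ ∧ ∀ (M : Type w) [ContPreStructure S M] (x y : Fin m → M),
      (∀ k, contDist S (x k) (y k) < δ) →
        contDist S (ContPreStructure.funMap f x) (ContPreStructure.funMap f y) ≤ ε := by
  have hη : 0 < ε / (m + 1) := by positivity
  obtain ⟨δ, hδ⟩ := Finite.exists_ge fun k => S.funModulus f k ⟨ε / (m + 1), hη⟩
  refine ⟨δ, δ.2, fun M _ x y hxy => ?_⟩
  have := le_mul_of_update_le
    (fun a b => contDist S (ContPreStructure.funMap f a) (ContPreStructure.funMap f b))
    (fun a => contDist_self _) (fun a b c => contDist_triangle _ _ _) x y (η := ε / (m + 1))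
    (fun k a => ContPreStructure.funMap_uc f k ⟨_, hη⟩ a _ _
      ((hxy k).trans_le (Subtype.coe_le_coe.2 (hδ k))))
  refine this.trans ?_
  rw [← mul_div_assoc, div_le_iff₀ (by positivity)]
  nlinarith

end UniformContinuity

theorem unitInterval.exists_dist_iInf_lt {ι : Type w} [Nonempty ι] (f : ι → unitInterval) {ε : ℝ}
    (hε : 0 < ε) : ∃ i, dist (f i) (⨅ i, f i) < ε := by
  by_contra! h
  have h' : ∀ i, ((⨅ i, f i : unitInterval) : ℝ) + ε ≤ f i := fun i => by
    have h1 := h i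
    have h2 : ((⨅ i, f i : unitInterval) : ℝ) ≤ f i := Subtype.coe_le_coe.2 (iInf_le f i)
    rw [Subtype.dist_eq, Real.dist_eq, abs_of_nonneg (by linarith)] at h1
    linarith
  obtain ⟨i⟩ := ‹Nonempty ι›
  have hmem : ((⨅ i, f i : unitInterval) : ℝ) + ε ∈ unitInterval :=
    ⟨by linarith [(⨅ i, f i : unitInterval).2.1], (h' i).trans (f i).2.2⟩
  have : (⟨_, hmem⟩ : unitInterval) ≤ ⨅ i, f i := le_iInf fun i => h' i
  have : ((⨅ i, f i : unitInterval) : ℝ) + ε ≤ ((⨅ i, f i : unitInterval) : ℝ) := this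
  linarith

theorem unitInterval.exists_dist_iSup_lt {ι : Type w} [Nonempty ι] (f : ι → unitInterval) {ε : ℝ}
    (hε : 0 < ε) : ∃ i, dist (f i) (⨆ i, f i) < ε := by
  by_contra! h
  have h' : ∀ i, (f i : ℝ) ≤ ((⨆ i, f i : unitInterval) : ℝ) - ε := fun i => by
    have h1 := h i
    have h2 : (f i : ℝ) ≤ ((⨆ i, f i : unitInterval) : ℝ) := Subtype.coe_le_coe.2 (le_iSup f i)
    rw [dist_comm, Subtype.dist_eq, Real.dist_eq, abs_of_nonneg (by linarith)] at h1
    linarith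
  obtain ⟨i⟩ := ‹Nonempty ι›
  have hmem : ((⨆ i, f i : unitInterval) : ℝ) - ε ∈ unitInterval :=
    ⟨(f i).2.1.trans (h' i), by linarith [(⨆ i, f i : unitInterval).2.2]⟩
  have : ⨆ i, f i ≤ (⟨_, hmem⟩ : unitInterval) := iSup_le fun i => h' i
  have : ((⨆ i, f i : unitInterval) : ℝ) ≤ ((⨆ i, f i : unitInterval) : ℝ) - ε := this
  linarith

/-! ### The limit structure and its Łoś theorem -/

/-- A model of `T` together with a family of elements indexed by `I`. -/
structure NamedModel {S : ContSignature.{u, v}} {F : ConnectiveSystem} (T : ContTheory S F)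
    (I : Type t) where
  /-- the underlying set of the model -/
  carrier : Type w
  /-- the structure of the model -/
  [str : ContStructure S carrier]
  isModel : T.IsModel carrier
  /-- the named elements -/
  name : I → carrier

attribute [instance] NamedModel.str

/-- A limit, along a filter, of models of `T` with named elements, in which every condition on
one further element that is approximately satisfiable along the filter is satisfied by a named
element. -/
structure SaturatedLimit {S : ContSignature.{u, v}} {F : ConnectiveSystem}
    (T : ContTheory S F) where
  /-- the names of the elements -/
  index : Type w
  /-- the filter along which the limit is taken -/
  filter : Filter (NamedModel.{u, v, w, w} T index)
  /-- the limit value of a formula -/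
  val : ∀ {n : ℕ}, ContFormula S F n → (Fin n → index) → unitInterval
  index_nonempty : Nonempty index
  neBot : filter.NeBot
  tendsto_val : ∀ {n : ℕ} (φ : ContFormula S F n) (a : Fin n → index),
    Tendsto (fun y => φ.value (y.name ∘ a)) filter (𝓝 (val φ a))
  exists_witness : ∀ (s : ℕ → index) (G : Set ((Σ n, ContFormula S F (n + 1)) × unitInterval)),
    (∀ G₀ : Finset ((Σ n, ContFormula S F (n + 1)) × unitInterval), ↑G₀ ⊆ G →
      ∀ ε : ℝ, 0 < ε → ∀ᶠ y in filter, ∃ c : y.carrier, ∀ g ∈ G₀,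
        dist (g.1.2.value (Fin.snoc (fun i : Fin g.1.1 => y.name (s i)) c :
          Fin (g.1.1 + 1) → y.carrier)) g.2 < ε) →
    ∃ j, ∀ g ∈ G, val g.1.2 (Fin.snoc (fun i : Fin g.1.1 => s i) j :
      Fin (g.1.1 + 1) → index) = g.2

namespace SaturatedLimit

attribute [instance] index_nonempty neBot

variable {S : ContSignature.{u, v}} {F : ConnectiveSystem} {T : ContTheory S F}
  (L : SaturatedLimit.{u, v, w} T)

theorem exists_witness_fin {n : ℕ} (a : Fin n → L.index)
    (G : Set (ContFormula S F (n + 1) × unitInterval))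
    (hG : ∀ G₀ : Finset (ContFormula S F (n + 1) × unitInterval), ↑G₀ ⊆ G →
      ∀ ε : ℝ, 0 < ε → ∀ᶠ y in L.filter, ∃ c : y.carrier, ∀ g ∈ G₀,
        dist (g.1.value (Fin.snoc (y.name ∘ a) c : Fin (n + 1) → y.carrier)) g.2 < ε) :
    ∃ j, ∀ g ∈ G, L.val g.1 (Fin.snoc a j : Fin (n + 1) → L.index) = g.2 := by
  classical
  obtain ⟨j₀⟩ := L.index_nonempty
  -- The tuple is padded to a sequence; conditions of arity `n + 1` never read the padding `j₀`.
  let s : ℕ → L.index := fun k => if h : k < n then a ⟨k, h⟩ else j₀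
  have hs : (fun i : Fin n => s i) = a := by funext i; simp [s]
  let e : ContFormula S F (n + 1) × unitInterval →
      (Σ n, ContFormula S F (n + 1)) × unitInterval := fun g => (⟨n, g.1⟩, g.2)
  obtain ⟨j, hj⟩ := L.exists_witness s (e '' G) (by
    intro G₀ hG₀ ε hε
    obtain ⟨G₁, hG₁, rfl⟩ := Finset.subset_set_image_iff.1 hG₀
    filter_upwards [hG G₁ hG₁ ε hε] with y hy
    obtain ⟨c, hc⟩ := hy
    refine ⟨c, fun g hg => ?_⟩
    obtain ⟨g, hg', rfl⟩ := Finset.mem_image.1 hg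
    have : (fun i : Fin n => y.name (s i)) = y.name ∘ a := by rw [← hs]; rfl
    simp only [e]
    rw [this]
    exact hc g hg')
  refine ⟨j, fun g hg => ?_⟩
  have := hj (e g) ⟨g, hg, rfl⟩
  simp only [e] at this
  rwa [hs] at this

theorem exists_witness_single {n : ℕ} (a : Fin n → L.index) (φ : ContFormula S F (n + 1))
    (r : unitInterval)
    (h : ∀ ε : ℝ, 0 < ε → ∀ᶠ y in L.filter, ∃ c : y.carrier,
      dist (φ.value (Fin.snoc (y.name ∘ a) c : Fin (n + 1) → y.carrier)) r < ε) :
    ∃ j, L.val φ (Fin.snoc a j : Fin (n + 1) → L.index) = r := by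
  obtain ⟨j, hj⟩ := L.exists_witness_fin a {(φ, r)} (by
    intro G₀ hG₀ ε hε
    filter_upwards [h ε hε] with y hy
    obtain ⟨c, hc⟩ := hy
    refine ⟨c, fun g hg => ?_⟩
    obtain rfl : g = (φ, r) := hG₀ hg
    exact hc)
  exact ⟨j, hj _ rfl⟩

theorem val_conn {n m : ℕ} (c : F m) (φ : Fin m → ContFormula S F n) (a : Fin n → L.index) :
    L.val (.conn c φ) a = c.1 fun i => L.val (φ i) a :=
  tendsto_nhds_unique (L.tendsto_val _ a) ((c.1.continuous.tendsto _).comp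
    (tendsto_pi_nhds.2 fun i => L.tendsto_val (φ i) a))

theorem tendsto_val_snoc {n : ℕ} (φ : ContFormula S F (n + 1)) (a : Fin n → L.index)
    (j : L.index) : Tendsto
      (fun y => φ.value (Fin.snoc (y.name ∘ a) (y.name j) : Fin (n + 1) → y.carrier)) L.filter
      (𝓝 (L.val φ (Fin.snoc a j : Fin (n + 1) → L.index))) := by
  simpa only [Fin.comp_snoc] using L.tendsto_val φ (Fin.snoc a j : Fin (n + 1) → L.index)

theorem nonempty_carrier (y : NamedModel.{u, v, w, w} T L.index) : Nonempty y.carrier :=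
  L.index_nonempty.map y.name

/-- One inequality passes to the limit. For the other, each model has an element nearly attaining
the infimum, so the condition that `φ` equals the limit infimum is approximately satisfiable; its
witness attains the infimum. -/
theorem val_inf {n : ℕ} (φ : ContFormula S F (n + 1)) (a : Fin n → L.index) :
    L.val (.inf φ) a = ⨅ j, L.val φ (Fin.snoc a j : Fin (n + 1) → L.index) := by
  refine le_antisymm (le_iInf fun j => ?_) ?_
  · exact le_of_tendsto_of_tendsto' (L.tendsto_val _ a) (L.tendsto_val_snoc φ a j)
      fun y => iInf_le _ _
  · obtain ⟨j, hj⟩ := L.exists_witness_single a φ (L.val (.inf φ) a) (by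
      intro ε hε
      filter_upwards [Metric.tendsto_nhds.1 (L.tendsto_val (.inf φ) a) (ε / 2) (half_pos hε)]
        with y hy
      have := L.nonempty_carrier y
      obtain ⟨c, hc⟩ := unitInterval.exists_dist_iInf_lt
        (fun c => φ.value (Fin.snoc (y.name ∘ a) c : Fin (n + 1) → y.carrier)) (half_pos hε)
      refine ⟨c, (dist_triangle _ _ _).trans_lt (lt_of_lt_of_eq (add_lt_add hc hy) ?_)⟩
      ring)
    rw [← hj]
    exact iInf_le _ j

theorem val_sup {n : ℕ} (φ : ContFormula S F (n + 1)) (a : Fin n → L.index) :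
    L.val (.sup φ) a = ⨆ j, L.val φ (Fin.snoc a j : Fin (n + 1) → L.index) := by
  refine le_antisymm ?_ (iSup_le fun j => ?_)
  · obtain ⟨j, hj⟩ := L.exists_witness_single a φ (L.val (.sup φ) a) (by
      intro ε hε
      filter_upwards [Metric.tendsto_nhds.1 (L.tendsto_val (.sup φ) a) (ε / 2) (half_pos hε)]
        with y hy
      have := L.nonempty_carrier y
      obtain ⟨c, hc⟩ := unitInterval.exists_dist_iSup_lt
        (fun c => φ.value (Fin.snoc (y.name ∘ a) c : Fin (n + 1) → y.carrier)) (half_pos hε)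
      refine ⟨c, (dist_triangle _ _ _).trans_lt (lt_of_lt_of_eq (add_lt_add hc hy) ?_)⟩
      ring)
    rw [← hj]
    exact le_iSup (fun j => L.val φ (Fin.snoc a j : Fin (n + 1) → L.index)) j
  · exact le_of_tendsto_of_tendsto' (L.tendsto_val_snoc φ a j) (L.tendsto_val _ a)
      fun y => le_iSup (fun c => φ.value (Fin.snoc (y.name ∘ a) c : Fin (n + 1) → y.carrier)) _

/-- Elements of the limit at distance zero are identified. -/
def setoid : Setoid L.index where
  r i j := Tendsto (fun y => contDist S (y.name i) (y.name j)) L.filter (𝓝 0)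
  iseqv :=
    { refl := fun i => by simp [contDist_self]
      symm := fun {i j} h => by simpa only [contDist_comm] using h
      trans := fun {i j k} h h' => by
        refine squeeze_zero (fun _ => contDist_nonneg _ _) (fun y => contDist_triangle _ _ (y.name j))
          ?_
        simpa using h.add h' }

/-- The underlying set of the limit structure. -/
def Carrier : Type w := Quotient L.setoid

/-- The element of the limit structure with a given name. -/
def toCarrier (j : L.index) : L.Carrier := Quotient.mk L.setoid j

theorem toCarrier_eq_iff {i j : L.index} : L.toCarrier i = L.toCarrier j ↔
    Tendsto (fun y => contDist S (y.name i) (y.name j)) L.filter (𝓝 0) :=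
  Quotient.eq (r := L.setoid)

/-- A name of an element of the limit structure. -/
noncomputable def out (q : L.Carrier) : L.index := Quotient.out q

@[simp] theorem toCarrier_out (q : L.Carrier) : L.toCarrier (L.out q) = q := Quotient.out_eq q

theorem toCarrier_surjective : Function.Surjective L.toCarrier := fun q => ⟨L.out q, L.toCarrier_out q⟩

theorem toCarrier_comp_surjective {m : ℕ} (q : Fin m → L.Carrier) : ∃ a, q = L.toCarrier ∘ a :=
  ⟨L.out ∘ q, by funext i; simp⟩

/-- The limit value of a predicate symbol. -/
def predVal {m : ℕ} (P : S.Relations m) (a : Fin m → L.index) : unitInterval :=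
  L.val (.atomic P fun i => .var i) a

theorem tendsto_predVal {m : ℕ} (P : S.Relations m) (a : Fin m → L.index) :
    Tendsto (fun y => (ContPreStructure.predMap P (y.name ∘ a) : ℝ)) L.filter
      (𝓝 (L.predVal P a)) :=
  (continuous_subtype_val.tendsto _).comp (L.tendsto_val (.atomic P fun i => .var i) a)

/-- The tuples may vary freely with the model: values of terms are in general not named elements,
only asymptotically close to them. -/
theorem tendsto_predMap_sub {m : ℕ} (P : S.Relations m)
    (a b : ∀ y : NamedModel.{u, v, w, w} T L.index, Fin m → y.carrier)
    (h : ∀ k, Tendsto (fun y => contDist S (a y k) (b y k)) L.filter (𝓝 0)) :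
    Tendsto (fun y => (ContPreStructure.predMap P (a y) : ℝ) - ContPreStructure.predMap P (b y))
      L.filter (𝓝 0) := by
  rw [Metric.tendsto_nhds]
  intro ε hε
  obtain ⟨δ, hδ, H⟩ := predMap_uniformContinuous.{u, v, w} P (half_pos hε)
  filter_upwards [eventually_all.2 fun k => (h k).eventually_lt_const hδ] with y hy
  rw [Real.dist_eq, sub_zero]
  exact (H _ _ _ hy).trans_lt (half_lt_self hε)

theorem tendsto_contDist_funMap {m : ℕ} (f : S.Functions m)
    (a b : ∀ y : NamedModel.{u, v, w, w} T L.index, Fin m → y.carrier)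
    (h : ∀ k, Tendsto (fun y => contDist S (a y k) (b y k)) L.filter (𝓝 0)) :
    Tendsto (fun y => contDist S (ContPreStructure.funMap f (a y))
      (ContPreStructure.funMap f (b y))) L.filter (𝓝 0) := by
  rw [Metric.tendsto_nhds]
  intro ε hε
  obtain ⟨δ, hδ, H⟩ := funMap_uniformContinuous.{u, v, w} f (half_pos hε)
  filter_upwards [eventually_all.2 fun k => (h k).eventually_lt_const hδ] with y hy
  rw [Real.dist_eq, sub_zero, abs_of_nonneg (contDist_nonneg _ _)]
  exact (H _ _ _ hy).trans_lt (half_lt_self hε)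

theorem predVal_congr {m : ℕ} (P : S.Relations m) {a b : Fin m → L.index}
    (h : L.toCarrier ∘ a = L.toCarrier ∘ b) : L.predVal P a = L.predVal P b := by
  have h1 := (L.tendsto_predVal P a).sub (L.tendsto_predVal P b)
  have h2 := L.tendsto_predMap_sub P (fun y => y.name ∘ a) (fun y => y.name ∘ b)
    fun k => L.toCarrier_eq_iff.1 (congrFun h k)
  exact Subtype.ext (sub_eq_zero.1 (tendsto_nhds_unique h1 h2))

/-- A name for the value is a witness to the condition `d(f(a), x) = 0`, which is satisfied exactly
in every model. -/
theorem exists_funVal {m : ℕ} (f : S.Functions m) (a : Fin m → L.index) :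
    ∃ j, Tendsto (fun y => contDist S (ContPreStructure.funMap f (y.name ∘ a)) (y.name j))
      L.filter (𝓝 0) := by
  let φ : ContFormula S F (m + 1) := .atomic S.distSymb
    ![.func f fun i => .var i.castSucc, .var (Fin.last m)]
  have hφ : ∀ (y : NamedModel.{u, v, w, w} T L.index) (c : y.carrier),
      (φ.value (Fin.snoc (y.name ∘ a) c : Fin (m + 1) → y.carrier) : ℝ) =
        contDist S (ContPreStructure.funMap f (y.name ∘ a)) c := by
    intro y c
    simp only [φ, ContFormula.value, contDist]
    congr 2
    funext k
    fin_cases k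
    · simp [termValue, Function.comp_def]
    · simp [termValue]
  obtain ⟨j, hj⟩ := L.exists_witness_single a φ 0 (by
    intro ε hε
    refine Eventually.of_forall fun y => ⟨ContPreStructure.funMap f (y.name ∘ a), ?_⟩
    rw [Subtype.dist_eq, hφ, contDist_self]
    simpa using hε)
  refine ⟨j, ?_⟩
  have h := (continuous_subtype_val.tendsto _).comp (L.tendsto_val_snoc φ a j)
  rw [hj] at h
  exact h.congr fun y => hφ y _

/-- A name of the value of a function symbol. -/
noncomputable def funVal {m : ℕ} (f : S.Functions m) (a : Fin m → L.index) : L.index :=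
  (L.exists_funVal f a).choose

theorem tendsto_funVal {m : ℕ} (f : S.Functions m) (a : Fin m → L.index) :
    Tendsto (fun y => contDist S (ContPreStructure.funMap f (y.name ∘ a)) (y.name (L.funVal f a)))
      L.filter (𝓝 0) :=
  (L.exists_funVal f a).choose_spec

theorem toCarrier_eq_of_tendsto {i j : L.index} (x : ∀ y : NamedModel.{u, v, w, w} T L.index, y.carrier)
    (hi : Tendsto (fun y => contDist S (x y) (y.name i)) L.filter (𝓝 0))
    (hj : Tendsto (fun y => contDist S (x y) (y.name j)) L.filter (𝓝 0)) : L.toCarrier i = L.toCarrier j := by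
  rw [L.toCarrier_eq_iff]
  refine squeeze_zero (fun _ => contDist_nonneg _ _) (fun y => contDist_triangle _ _ (x y)) ?_
  simpa [contDist_comm] using hi.add hj

theorem tendsto_funVal_of_tendsto {m : ℕ} (f : S.Functions m) (a : Fin m → L.index)
    (x : ∀ y : NamedModel.{u, v, w, w} T L.index, Fin m → y.carrier)
    (h : ∀ k, Tendsto (fun y => contDist S (x y k) (y.name (a k))) L.filter (𝓝 0)) :
    Tendsto (fun y => contDist S (ContPreStructure.funMap f (x y)) (y.name (L.funVal f a)))
      L.filter (𝓝 0) := by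
  refine squeeze_zero (fun _ => contDist_nonneg _ _)
    (fun y => contDist_triangle _ _ (ContPreStructure.funMap f (y.name ∘ a))) ?_
  simpa using (L.tendsto_contDist_funMap f x (fun y => y.name ∘ a) h).add (L.tendsto_funVal f a)

theorem toCarrier_funVal_congr {m : ℕ} (f : S.Functions m) {a b : Fin m → L.index}
    (h : L.toCarrier ∘ a = L.toCarrier ∘ b) : L.toCarrier (L.funVal f a) = L.toCarrier (L.funVal f b) :=
  L.toCarrier_eq_of_tendsto (fun y => ContPreStructure.funMap f (y.name ∘ a)) (L.tendsto_funVal f a)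
    (L.tendsto_funVal_of_tendsto f b _ fun k => L.toCarrier_eq_iff.1 (congrFun h k))

theorem predVal_out {m : ℕ} (P : S.Relations m) (a : Fin m → L.index) :
    L.predVal P (L.out ∘ L.toCarrier ∘ a) = L.predVal P a :=
  L.predVal_congr P (by funext i; simp)

theorem toCarrier_funVal_out {m : ℕ} (f : S.Functions m) (a : Fin m → L.index) :
    L.toCarrier (L.funVal f (L.out ∘ L.toCarrier ∘ a)) = L.toCarrier (L.funVal f a) :=
  L.toCarrier_funVal_congr f (by funext i; simp)

theorem toCarrier_vec_two (i j : L.index) : ![L.toCarrier i, L.toCarrier j] = L.toCarrier ∘ ![i, j] := by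
  funext k
  fin_cases k <;> rfl

theorem tendsto_contDist (i j : L.index) :
    Tendsto (fun y => contDist S (y.name i) (y.name j)) L.filter
      (𝓝 (L.predVal S.distSymb (L.out ∘ ![L.toCarrier i, L.toCarrier j]))) := by
  rw [toCarrier_vec_two, predVal_out]
  refine (L.tendsto_predVal S.distSymb ![i, j]).congr fun y => ?_
  simp only [contDist]
  congr 2
  funext k
  fin_cases k <;> rfl

/-- The continuity axioms survive because their hypothesis is strict and their conclusion is not: a
distance below the modulus in the limit is eventually below it in the models, and the resulting
bounds by `ε` pass to the limit. -/
noncomputable instance : ContPreStructure S L.Carrier where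
  funMap f q := L.toCarrier (L.funVal f (L.out ∘ q))
  predMap P q := L.predVal P (L.out ∘ q)
  d_self q := by
    obtain ⟨i, rfl⟩ := L.toCarrier_surjective q
    exact tendsto_nhds_unique (L.tendsto_contDist i i) (by simp [contDist_self])
  d_comm q q' := by
    obtain ⟨i, rfl⟩ := L.toCarrier_surjective q
    obtain ⟨j, rfl⟩ := L.toCarrier_surjective q'
    exact tendsto_nhds_unique (L.tendsto_contDist i j)
      (by simpa only [contDist_comm] using L.tendsto_contDist j i)
  d_triangle q q' q'' := by
    obtain ⟨i, rfl⟩ := L.toCarrier_surjective q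
    obtain ⟨j, rfl⟩ := L.toCarrier_surjective q'
    obtain ⟨k, rfl⟩ := L.toCarrier_surjective q''
    exact le_of_tendsto_of_tendsto' (L.tendsto_contDist i j)
      ((L.tendsto_contDist i k).add (L.tendsto_contDist k j))
      fun y => contDist_triangle _ _ _
  funMap_uc f i ε q z w' h := by
    obtain ⟨a, rfl⟩ := L.toCarrier_comp_surjective q
    obtain ⟨z, rfl⟩ := L.toCarrier_surjective z
    obtain ⟨w', rfl⟩ := L.toCarrier_surjective w'
    simp only [← Function.comp_update, toCarrier_funVal_out]
    have h1 := (L.tendsto_contDist z w').eventually_lt_const h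
    have h2 := ((L.tendsto_funVal f (Function.update a i z)).add_const (ε : ℝ)).add
      (L.tendsto_funVal f (Function.update a i w'))
    simp only [zero_add, add_zero] at h2
    refine le_of_tendsto_of_tendsto (L.tendsto_contDist _ _) h2 (h1.mono fun y hy => ?_)
    have h3 := ContPreStructure.funMap_uc f i ε (y.name ∘ a) _ _ hy
    simp only [← Function.comp_update] at h3
    have h4 := contDist_triangle (S := S) (y.name (L.funVal f (Function.update a i z)))
      (y.name (L.funVal f (Function.update a i w')))
      (ContPreStructure.funMap f (y.name ∘ Function.update a i z))
    have h5 := contDist_triangle (S := S)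
      (ContPreStructure.funMap f (y.name ∘ Function.update a i z))
      (y.name (L.funVal f (Function.update a i w')))
      (ContPreStructure.funMap f (y.name ∘ Function.update a i w'))
    rw [contDist_comm (y.name (L.funVal f (Function.update a i z)))
      (ContPreStructure.funMap f _)] at h4
    change contDist S _ _ ≤ _ at h3
    change contDist S _ _ ≤ _
    dsimp only
    linarith
  predMap_uc P i ε q z w' h := by
    obtain ⟨a, rfl⟩ := L.toCarrier_comp_surjective q
    obtain ⟨z, rfl⟩ := L.toCarrier_surjective z
    obtain ⟨w', rfl⟩ := L.toCarrier_surjective w'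
    simp only [← Function.comp_update, predVal_out]
    have h1 := (L.tendsto_contDist z w').eventually_lt_const h
    refine le_of_tendsto ((L.tendsto_predVal P (Function.update a i z)).sub
      (L.tendsto_predVal P (Function.update a i w'))) (h1.mono fun y hy => ?_)
    have h3 := ContPreStructure.predMap_uc P i ε (y.name ∘ a) _ _ hy
    simpa only [← Function.comp_update] using h3

theorem tendsto_contDist_toCarrier (i j : L.index) :
    Tendsto (fun y => contDist S (y.name i) (y.name j)) L.filter
      (𝓝 (contDist S (L.toCarrier i) (L.toCarrier j))) :=
  L.tendsto_contDist i j

/-- The limit of a Cauchy sequence is a witness to the countably many conditions `d(s k, x) = r k`,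
where `r k` is the limit of `d(s k, s m)` in `m`. A late term of the sequence satisfies any finitely
many of them approximately, and `r k` tends to 0. -/
theorem exists_limit (s : ℕ → L.Carrier)
    (hs : ∀ ε : ℝ, 0 < ε → ∃ N : ℕ, ∀ m ≥ N, ∀ n ≥ N, contDist S (s m) (s n) < ε) :
    ∃ x : L.Carrier, ∀ ε : ℝ, 0 < ε → ∃ N : ℕ, ∀ n ≥ N, contDist S (s n) x < ε := by
  set s' : ℕ → L.index := fun n => L.out (s n)
  have hmk : ∀ n, L.toCarrier (s' n) = s n := fun n => L.toCarrier_out _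
  let d : ℕ → ℕ → unitInterval := fun k m => ContPreStructure.predMap S.distSymb ![s k, s m]
  have hd : ∀ k m, (d k m : ℝ) = contDist S (s k) (s m) := fun _ _ => rfl
  have hlim : ∀ k, ∃ r : unitInterval, Tendsto (d k) atTop (𝓝 r) := by
    intro k
    refine cauchySeq_tendsto_of_complete (Metric.cauchySeq_iff.2 fun ε hε => ?_)
    obtain ⟨N, hN⟩ := hs ε hε
    refine ⟨N, fun m hm n hn => ?_⟩
    rw [Subtype.dist_eq, Real.dist_eq, hd, hd, abs_lt]
    have h1 := contDist_triangle (S := S) (s k) (s m) (s n)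
    have h2 := contDist_triangle (S := S) (s k) (s n) (s m)
    have h3 := hN m hm n hn
    have h4 := hN n hn m hm
    constructor <;> linarith
  choose r hr using hlim
  -- The condition on `s k` has the whole initial segment up to `k` as parameters, but reads only
  -- the last of them.
  let φ : ∀ k : ℕ, ContFormula S F (k + 1 + 1) := fun k => .atomic S.distSymb
    ![.var (Fin.last k).castSucc, .var (Fin.last (k + 1))]
  have hφ : ∀ (k : ℕ) (y : NamedModel.{u, v, w, w} T L.index) (c : y.carrier),
      ((φ k).value (Fin.snoc (fun i : Fin (k + 1) => y.name (s' i)) c :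
        Fin (k + 1 + 1) → y.carrier) : ℝ) = contDist S (y.name (s' k)) c := by
    intro k y c
    simp only [φ, ContFormula.value, contDist]
    congr 2
    funext i
    fin_cases i
    · simp [termValue]
    · simp [termValue]
  obtain ⟨j, hj⟩ := L.exists_witness s'
    (Set.range fun k => ((⟨k + 1, φ k⟩ : Σ n, ContFormula S F (n + 1)), r k)) (by
      classical
      intro G₀ hG₀ ε hε
      rw [← Set.image_univ] at hG₀
      obtain ⟨K, -, rfl⟩ := Finset.subset_set_image_iff.1 hG₀
      have h1 : ∀ᶠ m in atTop, ∀ k ∈ K, dist (d k m) (r k) < ε / 2 :=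
        (Filter.eventually_all_finset K).2 fun k _ => Metric.tendsto_nhds.1 (hr k) _ (half_pos hε)
      obtain ⟨m, hm⟩ := h1.exists
      have h2 : ∀ᶠ y in L.filter, ∀ k ∈ K,
          dist (contDist S (y.name (s' k)) (y.name (s' m))) (d k m) < ε / 2 :=
        (Filter.eventually_all_finset K).2 fun k _ => by
          have := L.tendsto_contDist_toCarrier (s' k) (s' m)
          rw [hmk, hmk] at this
          exact Metric.tendsto_nhds.1 this _ (half_pos hε)
      filter_upwards [h2] with y hy
      refine ⟨y.name (s' m), fun g hg => ?_⟩
      obtain ⟨k, hk, rfl⟩ := Finset.mem_image.1 hg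
      rw [Subtype.dist_eq, hφ]
      exact (dist_triangle _ _ _).trans_lt
        (lt_of_lt_of_eq (add_lt_add (hy k hk) (hm k hk)) (by ring)))
  have hjr : ∀ k, contDist S (s k) (L.toCarrier j) = r k := by
    intro k
    have h1 : L.val (φ k) (Fin.snoc (fun i : Fin (k + 1) => s' i) j : Fin (k + 1 + 1) → L.index)
      = r k := hj _ ⟨k, rfl⟩
    have h2 := (continuous_subtype_val.tendsto _).comp
      (L.tendsto_val_snoc (φ k) (fun i : Fin (k + 1) => s' i) j)
    have h3 := L.tendsto_contDist_toCarrier (s' k) j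
    rw [hmk] at h3
    rw [h1] at h2
    exact tendsto_nhds_unique h3 (h2.congr fun y => hφ k y _)
  refine ⟨L.toCarrier j, fun ε hε => ?_⟩
  obtain ⟨N, hN⟩ := hs (ε / 2) (half_pos hε)
  refine ⟨N, fun n hn => ?_⟩
  rw [hjr]
  refine lt_of_le_of_lt (le_of_tendsto ((continuous_subtype_val.tendsto _).comp (hr n)) ?_)
    (half_lt_self hε)
  exact (eventually_ge_atTop N).mono fun m hm => (hN n hn m hm).le

noncomputable instance : ContStructure S L.Carrier where
  eq_of_dist_eq_zero q q' h := by
    obtain ⟨i, rfl⟩ := L.toCarrier_surjective q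
    obtain ⟨j, rfl⟩ := L.toCarrier_surjective q'
    have := L.tendsto_contDist_toCarrier i j
    rw [L.toCarrier_eq_iff, ← h]
    exact this
  complete := L.exists_limit

/-- Names represent function values only up to a vanishing distance; uniform continuity carries
these errors through the term. -/
theorem termValue_toCarrier {n : ℕ} (a : Fin n → L.index) (t : S.Term (Fin n)) (j : L.index)
    (h : termValue (L.toCarrier ∘ a) t = L.toCarrier j) :
    Tendsto (fun y => contDist S (termValue (y.name ∘ a) t) (y.name j)) L.filter (𝓝 0) := by
  induction t generalizing j with
  | var i => exact L.toCarrier_eq_iff.1 h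
  | func f t ih =>
    let b : _ → L.index := fun i => L.out (termValue (L.toCarrier ∘ a) (t i))
    have h1 := L.tendsto_funVal_of_tendsto f b (fun y i => termValue (y.name ∘ a) (t i))
      fun k => ih k (b k) (L.toCarrier_out _).symm
    have h2 : L.toCarrier (L.funVal f b) = L.toCarrier j := h
    refine squeeze_zero (fun _ => contDist_nonneg _ _) 
      (fun y => contDist_triangle _ _ (y.name (L.funVal f b))) ?_
    simpa [termValue] using h1.add (L.toCarrier_eq_iff.1 h2)

/-- The values of formulae in the limit structure are the limit values. -/
theorem value_toCarrier {n : ℕ} (φ : ContFormula S F n) (a : Fin n → L.index) :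
    φ.value (L.toCarrier ∘ a) = L.val φ a := by
  induction φ with
  | atomic P t =>
    let b : _ → L.index := fun i => L.out (termValue (L.toCarrier ∘ a) (t i))
    have h1 := (continuous_subtype_val.tendsto _).comp (L.tendsto_val (.atomic P t) a)
    have h2 := L.tendsto_predMap_sub P (fun y i => termValue (y.name ∘ a) (t i))
      (fun y => y.name ∘ b) fun k => L.termValue_toCarrier a (t k) (b k) (L.toCarrier_out _).symm
    have h3 := h1.sub (L.tendsto_predVal P b)
    exact (Subtype.ext (sub_eq_zero.1 (tendsto_nhds_unique h3 h2))).symm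
  | conn c φ ih =>
    rw [L.val_conn]
    simp only [ContFormula.value, ih]
  | inf φ ih =>
    rw [L.val_inf]
    simp only [ContFormula.value]
    rw [← L.toCarrier_surjective.iInf_comp]
    simp only [← Fin.comp_snoc, ih]
  | sup φ ih =>
    rw [L.val_sup]
    simp only [ContFormula.value]
    rw [← L.toCarrier_surjective.iSup_comp]
    simp only [← Fin.comp_snoc, ih]

theorem tendsto_value {n : ℕ} (φ : ContFormula S F n) (a : Fin n → L.index) :
    Tendsto (fun y => φ.value (y.name ∘ a)) L.filter (𝓝 (φ.value (L.toCarrier ∘ a))) := by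
  rw [L.value_toCarrier]
  exact L.tendsto_val φ a

theorem isModel : T.IsModel L.Carrier := by
  intro φ hφ
  have h := L.tendsto_value φ Fin.elim0
  rw [Subsingleton.elim (L.toCarrier ∘ Fin.elim0) (Fin.elim0 : Fin 0 → L.Carrier)] at h
  refine tendsto_nhds_unique h (tendsto_const_nhds.congr fun y => ?_)
  rw [Subsingleton.elim (y.name ∘ Fin.elim0) (Fin.elim0 : Fin 0 → y.carrier)]
  exact (y.isModel φ hφ).symm

end SaturatedLimit

/-! ### Saturation of the limit structure -/

/-- The sup-distance to a point of the cube, as a continuous function on the cube. -/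
noncomputable def cubeDist {k : ℕ} (r : Fin k → unitInterval) :
    C(Fin k → unitInterval, unitInterval) where
  toFun v := ⟨dist v r, dist_nonneg, (dist_pi_le_iff zero_le_one).2 fun i =>
    Real.dist_le_of_mem_Icc_01 (v i).2 (r i).2⟩
  continuous_toFun := by fun_prop

/-- Finitely many conditions of the type merge into one formula `ψ` close to the distance from their
values to the required values. Since `c` makes this distance 0, `inf ψ` is small at `b`, hence at
the tuple of the same type in the limit, hence eventually in the models. So the type is
approximately satisfiable and has a witness. -/
theorem SaturatedLimit.isOmegaSaturated {S : ContSignature.{u, v}} {F : ConnectiveSystem}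
    (hF : F.IsFull) {T : ContTheory S F} (L : SaturatedLimit.{u, v, max u v w} T) :
    IsOmegaSaturated.{u, v, w} S F L.Carrier := by
  classical
  intro n q N _ b hab c
  obtain ⟨a, rfl⟩ := L.toCarrier_comp_surjective q
  let r : ContFormula S F (n + 1) → unitInterval := fun φ =>
    φ.value (Fin.snoc b c : Fin (n + 1) → N)
  obtain ⟨j, hj⟩ := L.exists_witness_fin a (Set.range fun φ => (φ, r φ)) (by
    intro G₀ hG₀ ε hε
    rw [← Set.image_univ] at hG₀
    obtain ⟨K, -, rfl⟩ := Finset.subset_set_image_iff.1 hG₀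
    -- Fullness only concerns positive arities, so the empty set of conditions is treated apart.
    rcases K.eq_empty_or_nonempty with rfl | hK
    · exact Eventually.of_forall fun y => ⟨(L.nonempty_carrier y).some, by simp⟩
    let φ : Fin K.card → ContFormula S F (n + 1) := fun i => K.equivFin.symm i
    -- Three errors of `ε / 4` add up: the bound on `inf ψ`, the choice of `c'` near the infimum,
    -- and the approximation of the distance by `ψ`.
    have hε4 : 0 < ε / 4 := by positivity
    obtain ⟨ψ, -, hψ⟩ := ContFormula.exists_value_near.{u, v, max u v w} hF hK.card_pos
      (cubeDist fun i => r (φ i)) hε4 φ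
    have h1 : ((ContFormula.inf ψ).value (L.toCarrier ∘ a) : ℝ) < ε / 4 := by
      rw [hab]
      refine lt_of_le_of_lt (b := (ψ.value (Fin.snoc b c : Fin (n + 1) → N) : ℝ))
        (Subtype.coe_le_coe.2 (iInf_le _ c)) ?_
      have := (le_abs_self _).trans_lt (hψ N (Fin.snoc b c : Fin (n + 1) → N))
      simpa [cubeDist, r] using this
    filter_upwards [((continuous_subtype_val.tendsto _).comp
      (L.tendsto_value (.inf ψ) a)).eventually_lt_const h1] with y hy
    have := L.nonempty_carrier y
    obtain ⟨c', hc'⟩ := unitInterval.exists_dist_iInf_lt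
      (fun c => ψ.value (Fin.snoc (y.name ∘ a) c : Fin (n + 1) → y.carrier)) hε4
    refine ⟨c', fun g hg => ?_⟩
    obtain ⟨χ, hχ, rfl⟩ := Finset.mem_image.1 hg
    have h2 := (neg_le_abs _).trans_lt (hψ y.carrier (Fin.snoc (y.name ∘ a) c'))
    have h3 := (le_abs_self _).trans_lt hc'
    have h4 : φ (K.equivFin ⟨χ, hχ⟩) = χ := by simp [φ]
    have h5 := dist_le_pi_dist
      (fun i => (φ i).value (Fin.snoc (y.name ∘ a) c' : Fin (n + 1) → y.carrier))
      (fun i => r (φ i)) (K.equivFin ⟨χ, hχ⟩)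
    simp only [h4] at h5
    refine h5.trans_lt ?_
    simp only [cubeDist, ContinuousMap.coe_mk, Function.comp_apply, ContFormula.value] at h2 h3 hy
    linarith)
  refine ⟨L.toCarrier j, fun φ => ?_⟩
  rw [← Fin.comp_snoc, L.value_toCarrier]
  exact hj _ ⟨φ, rfl⟩

/-! ### Filters on models, and naming a new element -/

theorem Ultrafilter.exists_tendsto {α : Type w} {X : Type t} [TopologicalSpace X] [CompactSpace X]
    (l : Ultrafilter α) (f : α → X) : ∃ r, Tendsto f l (𝓝 r) :=
  ⟨(l.map f).lim, (l.map f).le_nhds_lim⟩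

theorem Filter.neBot_bind {α : Type w} {β : Type t} {l : Filter α} [l.NeBot] {m : α → Filter β}
    (h : ∀ x, (m x).NeBot) : (l.bind m).NeBot := by
  refine ⟨fun hbot => ?_⟩
  have h1 : ∀ᶠ _ in l.bind m, False := by rw [hbot]; trivial
  obtain ⟨x, hx⟩ := (eventually_bind.1 h1).exists
  exact (h x).ne (eventually_false_iff_eq_bot.1 hx)

section Extension

variable {S : ContSignature.{u, v}} {F : ConnectiveSystem} {T : ContTheory S F} {I : Type t}

/-- The value of a formula at a tuple of named elements. -/
noncomputable def NamedModel.eval (y : NamedModel.{u, v, w, t} T I)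
    (P : Σ n, ContFormula S F n × (Fin n → I)) : unitInterval :=
  P.2.1.value (y.name ∘ P.2.2)

/-- The formulae instantiated by elements of `J`. -/
def instancesOver (S : ContSignature.{u, v}) (F : ConnectiveSystem) (J : Set I) :
    Set (Σ n, ContFormula S F n × (Fin n → I)) :=
  {P | ∀ i, P.2.2 i ∈ J}

/-- The filter on models generated by approximate equality with `p` over `J`. -/
noncomputable def approxFilter (T : ContTheory S F) (J : Set I)
    (p : (Σ n, ContFormula S F n × (Fin n → I)) → unitInterval) :
    Filter (NamedModel.{u, v, w, t} T I) :=
  ⨅ P : instancesOver S F J, comap (fun y => y.eval P.1) (𝓝 (p P))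

theorem le_approxFilter_iff {J : Set I}
    {p : (Σ n, ContFormula S F n × (Fin n → I)) → unitInterval}
    {l : Filter (NamedModel.{u, v, w, t} T I)} :
    l ≤ approxFilter T J p ↔ ∀ P ∈ instancesOver S F J, Tendsto (fun y => y.eval P) l (𝓝 (p P)) := by
  simp only [approxFilter, le_iInf_iff, ← tendsto_iff_comap, Subtype.forall]

theorem tendsto_eval {J : Set I} {p : (Σ n, ContFormula S F n × (Fin n → I)) → unitInterval}
    {P : Σ n, ContFormula S F n × (Fin n → I)} (hP : P ∈ instancesOver S F J) :
    Tendsto (fun y => y.eval P) (approxFilter.{u, v, w, t} T J p) (𝓝 (p P)) :=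
  le_approxFilter_iff.1 le_rfl P hP

/-- If conditions on a new element are approximately satisfiable along a filter of models, then
the new element can be named so that they hold in the limit. -/
theorem exists_filter_extension {l : Filter (NamedModel.{u, v, w, t} T I)} [l.NeBot] (i : I)
    (s : ℕ → I) (hs : ∀ k, s k ≠ i)
    (G : Set ((Σ n, ContFormula S F (n + 1)) × unitInterval))
    (hG : ∀ G₀ : Finset ((Σ n, ContFormula S F (n + 1)) × unitInterval), ↑G₀ ⊆ G →
      ∀ ε : ℝ, 0 < ε → ∀ᶠ y in l, ∃ c : y.carrier, ∀ g ∈ G₀,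
        dist (g.1.2.value (Fin.snoc (fun i : Fin g.1.1 => y.name (s i)) c :
          Fin (g.1.1 + 1) → y.carrier)) g.2 < ε) :
    ∃ l' : Filter (NamedModel.{u, v, w, t} T I), l'.NeBot ∧
      (∀ P : Σ n, ContFormula S F n × (Fin n → I), (∀ k, P.2.2 k ≠ i) → ∀ r,
        Tendsto (fun y => y.eval P) l (𝓝 r) → Tendsto (fun y => y.eval P) l' (𝓝 r)) ∧
      ∀ g ∈ G, Tendsto (fun y => y.eval ⟨g.1.1 + 1, g.1.2,
        (Fin.snoc (fun k : Fin g.1.1 => s k) i : Fin (g.1.1 + 1) → I)⟩) l' (𝓝 g.2) := by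
  classical
  -- An index is a finite part of `G` together with a tolerance `1 / (N + 1)`.
  let K := Finset G × ℕ
  have hchoice : ∀ (κ : K) (y : NamedModel.{u, v, w, t} T I), ∃ c : y.carrier,
      (∃ c : y.carrier, ∀ g ∈ κ.1.map (Function.Embedding.subtype _),
        dist (g.1.2.value (Fin.snoc (fun i : Fin g.1.1 => y.name (s i)) c :
          Fin (g.1.1 + 1) → y.carrier)) g.2 < 1 / ((κ.2 : ℝ) + 1)) →
      ∀ g ∈ κ.1.map (Function.Embedding.subtype _),
        dist (g.1.2.value (Fin.snoc (fun i : Fin g.1.1 => y.name (s i)) c :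
          Fin (g.1.1 + 1) → y.carrier)) g.2 < 1 / ((κ.2 : ℝ) + 1) := by
    intro κ y
    by_cases h : ∃ c : y.carrier, ∀ g ∈ κ.1.map (Function.Embedding.subtype _),
        dist (g.1.2.value (Fin.snoc (fun i : Fin g.1.1 => y.name (s i)) c :
          Fin (g.1.1 + 1) → y.carrier)) g.2 < 1 / ((κ.2 : ℝ) + 1)
    · exact h.imp fun c hc _ => hc
    · exact ⟨y.name i, fun h' => absurd h' h⟩
  choose c hc using hchoice
  let Φ : K → NamedModel.{u, v, w, t} T I → NamedModel.{u, v, w, t} T I := fun κ y =>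
    { carrier := y.carrier, isModel := y.isModel, name := Function.update y.name i (c κ y) }
  -- How far along `l` one must go depends on the index, so the new filter is an iterated limit:
  -- first along `l`, then along the indices.
  refine ⟨(atTop : Filter K).bind fun κ => l.map (Φ κ), neBot_bind fun κ => inferInstance,
    fun P hP r h => ?_, fun g hg => ?_⟩
  · intro V hV
    change ∀ᶠ y in (atTop : Filter K).bind fun κ => l.map (Φ κ), y.eval P ∈ V
    refine eventually_bind.2 (Eventually.of_forall fun κ => ?_)
    have hV' : ∀ᶠ y in l, y.eval P ∈ V := h hV
    refine eventually_map.2 ?_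
    filter_upwards [hV'] with y hy
    have : (Φ κ y).name ∘ P.2.2 = y.name ∘ P.2.2 :=
      funext fun k => Function.update_of_ne (hP k) _ _
    change P.2.1.value ((Φ κ y).name ∘ P.2.2) ∈ V
    rw [this]
    exact hy
  · rw [Metric.tendsto_nhds]
    intro ε hε
    obtain ⟨N, hN⟩ := exists_nat_one_div_lt hε
    refine eventually_bind.2 ((eventually_ge_atTop (({⟨g, hg⟩}, N) : K)).mono fun κ hκ => ?_)
    have hgκ : g ∈ κ.1.map (Function.Embedding.subtype _) :=
      Finset.mem_map.2 ⟨⟨g, hg⟩, hκ.1 (Finset.mem_singleton_self _), rfl⟩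
    have hκε : 1 / ((κ.2 : ℝ) + 1) < ε := by
      refine lt_of_le_of_lt (one_div_le_one_div_of_le (by positivity) ?_) hN
      have : (N : ℝ) ≤ κ.2 := by exact_mod_cast hκ.2
      linarith
    refine eventually_map.2 ?_
    filter_upwards [hG (κ.1.map (Function.Embedding.subtype _)) (by
      intro g' hg'
      obtain ⟨g', -, rfl⟩ := Finset.mem_map.1 hg'
      exact g'.2) (1 / ((κ.2 : ℝ) + 1)) (by positivity)] with y hy
    have h1 := hc κ y hy g hgκ
    have h2 : (Φ κ y).name ∘ (Fin.snoc (fun k : Fin g.1.1 => s k) i : Fin (g.1.1 + 1) → I) =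
        Fin.snoc (fun k : Fin g.1.1 => y.name (s k)) (c κ y) := by
      rw [Fin.comp_snoc]
      congr 1
      · funext k
        exact Function.update_of_ne (hs k) _ _
      · exact Function.update_self i (c κ y) y.name
    change dist (g.1.2.value ((Φ κ y).name ∘ _)) _ < ε
    rw [h2]
    exact h1.trans hκε

end Extension

/-! ### Witness names, and maximal diagrams by Zorn's lemma -/

/-- Names of elements of a saturated structure: elements of `B`, and witnesses to sets of
conditions over countably many named elements. -/
inductive WitnessName (S : ContSignature.{u, v}) (F : ConnectiveSystem) (B : Type) :
    Type (max u v w)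
  | base (b : B)
  | wit (s : ℕ → WitnessName S F B) (G : Set ((Σ n, ContFormula S F (n + 1)) × unitInterval))

/-- Limit values for the formulae instantiated by a set of names. -/
structure Diagram (S : ContSignature.{u, v}) (F : ConnectiveSystem) (I : Type t) where
  /-- the names in use -/
  names : Set I
  /-- the limit values, relevant only for instances over `names` -/
  val : (Σ n, ContFormula S F n × (Fin n → I)) → unitInterval

namespace Diagram

variable {S : ContSignature.{u, v}} {F : ConnectiveSystem} {T : ContTheory S F}

/-- This is only a preorder, since values at instances outside `names` are arbitrary and are not
compared. -/
instance {I : Type t} : Preorder (Diagram S F I) where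
  le x y := x.names ⊆ y.names ∧ ∀ P ∈ instancesOver S F x.names, x.val P = y.val P
  le_refl x := ⟨subset_rfl, fun _ _ => rfl⟩
  le_trans x y z hxy hyz := ⟨hxy.1.trans hyz.1, fun P hP =>
    (hxy.2 P hP).trans (hyz.2 P fun i => hxy.1 (hP i))⟩

theorem approxFilter_anti {I : Type t} {x y : Diagram S F I} (h : x ≤ y) :
    approxFilter.{u, v, w, t} T y.names y.val ≤ approxFilter T x.names x.val :=
  le_approxFilter_iff.2 fun P hP => by
    rw [h.2 P hP]
    exact tendsto_eval fun i => h.1 (hP i)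

/-- The diagram is approximated by models of `T`, and the witnesses satisfy their conditions. -/
structure IsWitnessed {B : Type} (T : ContTheory S F)
    (x : Diagram S F (WitnessName.{u, v, w} S F B)) : Prop where
  neBot : (approxFilter.{u, v, max u v w, max u v w} T x.names x.val).NeBot
  mem_of_wit_mem : ∀ s G, .wit s G ∈ x.names → ∀ k, s k ∈ x.names
  val_wit : ∀ s G, .wit s G ∈ x.names → ∀ g ∈ G, x.val ⟨g.1.1 + 1, g.1.2,
    (Fin.snoc (fun k : Fin g.1.1 => s k) (.wit s G) :
      Fin (g.1.1 + 1) → WitnessName.{u, v, w} S F B)⟩ = g.2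

/-- An instance of a formula involves finitely many names, so an instance over the union of the
chain already lies over one member, and the members of the chain agree on it. -/
theorem exists_upper_bound {I : Type t} {c : Set (Diagram S F I)} (hc : IsChain (· ≤ ·) c)
    (hne : c.Nonempty) : ∃ z : Diagram S F I, z.names = ⋃ x ∈ c, x.names ∧
      (∀ x ∈ c, x ≤ z) ∧ ∀ P ∈ instancesOver S F z.names, ∃ x ∈ c, P ∈ instancesOver S F x.names := by
  classical
  let J : Set I := ⋃ x ∈ c, x.names
  have hdir : ∀ P ∈ instancesOver S F J, ∃ x ∈ c, P ∈ instancesOver S F x.names := by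
    intro P hP
    have hP' : ∀ i, ∃ x : c, P.2.2 i ∈ x.1.names := fun i => by
      have := hP i
      simp only [J, Set.mem_iUnion] at this
      obtain ⟨x, hx, h⟩ := this
      exact ⟨⟨x, hx⟩, h⟩
    choose x hx using hP'
    have : Nonempty c := hne.to_subtype
    have : IsDirectedOrder c := ⟨fun a b => by
      rcases hc.total a.2 b.2 with h | h
      · exact ⟨b, h, le_rfl⟩
      · exact ⟨a, le_rfl, h⟩⟩
    obtain ⟨z, hz⟩ := Finite.exists_le x
    exact ⟨z, z.2, fun i => (hz i).1 (hx i)⟩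
  let p : (Σ n, ContFormula S F n × (Fin n → I)) → unitInterval := fun P =>
    if h : ∃ x ∈ c, P ∈ instancesOver S F x.names then h.choose.val P else 0
  refine ⟨⟨J, p⟩, rfl, fun x hx => ⟨Set.subset_biUnion_of_mem hx, fun P hP => ?_⟩, hdir⟩
  have h : ∃ x ∈ c, P ∈ instancesOver S F x.names := ⟨x, hx, hP⟩
  simp only [p, dif_pos h]
  obtain ⟨h1, h2⟩ := h.choose_spec
  rcases hc.total hx h1 with h3 | h3
  · exact h3.2 P hP
  · exact (h3.2 P h2).symm

theorem IsWitnessed.exists_upper_bound {B : Type}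
    {c : Set (Diagram S F (WitnessName.{u, v, w} S F B))} (hw : ∀ x ∈ c, x.IsWitnessed T)
    (hc : IsChain (· ≤ ·) c) (hne : c.Nonempty) :
    ∃ z : Diagram S F (WitnessName.{u, v, w} S F B), z.IsWitnessed T ∧ ∀ x ∈ c, x ≤ z := by
  obtain ⟨z, hz, hle, hdir⟩ := Diagram.exists_upper_bound hc hne
  have hmem : ∀ i ∈ z.names, ∃ x ∈ c, i ∈ x.names := fun i hi => by
    rw [hz] at hi
    simpa using hi
  refine ⟨z, ⟨?_, fun s G h k => ?_, fun s G h g hg => ?_⟩, hle⟩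
  · have : Nonempty c := hne.to_subtype
    -- The filters of the members are directed, so their infimum is proper; it refines the filter of
    -- the union.
    have h1 : (⨅ x : c, approxFilter.{u, v, max u v w, max u v w} T x.1.names x.1.val).NeBot := by
      refine iInf_neBot_of_directed' (fun a b => ?_) fun x => (hw x x.2).neBot
      rcases hc.total a.2 b.2 with h | h
      · exact ⟨b, approxFilter_anti h, le_rfl⟩
      · exact ⟨a, le_rfl, approxFilter_anti h⟩
    refine h1.mono (le_approxFilter_iff.2 fun P hP => ?_)
    obtain ⟨x, hx, hPx⟩ := hdir P hP
    rw [← (hle x hx).2 P hPx]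
    exact (tendsto_eval hPx).mono_left (iInf_le _ (⟨x, hx⟩ : c))
  · obtain ⟨x, hx, h'⟩ := hmem _ h
    exact (hle x hx).1 ((hw x hx).mem_of_wit_mem s G h' k)
  · obtain ⟨x, hx, h'⟩ := hmem _ h
    rw [← (hle x hx).2]
    · exact (hw x hx).val_wit s G h' g hg
    · intro i
      refine Fin.lastCases ?_ (fun k => ?_) i
      · simpa using h'
      · simpa using (hw x hx).mem_of_wit_mem s G h' k

/-- In a maximal witnessed diagram, every approximately satisfiable set of conditions has a
witness. -/
theorem wit_mem_of_maximal {B : Type} {x : Diagram S F (WitnessName.{u, v, w} S F B)}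
    (hx : Maximal (IsWitnessed T) x) (s : ℕ → WitnessName.{u, v, w} S F B)
    (hs : ∀ k, s k ∈ x.names) (G : Set ((Σ n, ContFormula S F (n + 1)) × unitInterval))
    (hG : ∀ G₀ : Finset ((Σ n, ContFormula S F (n + 1)) × unitInterval), ↑G₀ ⊆ G →
      ∀ ε : ℝ, 0 < ε → ∀ᶠ y in approxFilter.{u, v, max u v w, max u v w} T x.names x.val,
        ∃ c : y.carrier, ∀ g ∈ G₀,
          dist (g.1.2.value (Fin.snoc (fun i : Fin g.1.1 => y.name (s i)) c :
            Fin (g.1.1 + 1) → y.carrier)) g.2 < ε) :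
    .wit s G ∈ x.names := by
  by_contra hwit
  have hne : ∀ j ∈ x.names, j ≠ .wit s G := fun j hj h => hwit (h ▸ hj)
  have := hx.prop.neBot
  obtain ⟨l, hl, hlJ, hlG⟩ := exists_filter_extension (.wit s G) s (fun k => hne _ (hs k)) G hG
  -- An ultrafilter gives every instance a limit value, including the new instances that involve the
  -- witness.
  choose p hp using fun P => (Ultrafilter.of l).exists_tendsto
    fun y : NamedModel.{u, v, max u v w, max u v w} T (WitnessName.{u, v, w} S F B) => y.eval P
  let z : Diagram S F (WitnessName.{u, v, w} S F B) := ⟨insert (.wit s G) x.names, p⟩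
  have hxz : x ≤ z := ⟨Set.subset_insert _ _, fun P hP =>
    tendsto_nhds_unique ((hlJ P (fun k => hne _ (hP k)) _ (tendsto_eval hP)).mono_left
      (Ultrafilter.of_le l)) (hp P)⟩
  have hz : z.IsWitnessed T := by
    refine ⟨(Ultrafilter.of l).neBot.mono (le_approxFilter_iff.2 fun P _ => hp P),
      fun s' G' h k => ?_, fun s' G' h g hg => ?_⟩
    · rcases h with h | h
      · cases h
        exact hxz.1 (hs k)
      · exact hxz.1 (hx.prop.mem_of_wit_mem s' G' h k)
    · rcases h with h | h
      · cases h
        exact tendsto_nhds_unique (hp _) ((hlG g hg).mono_left (Ultrafilter.of_le l))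
      · rw [← hxz.2]
        · exact hx.prop.val_wit s' G' h g hg
        · intro i
          refine Fin.lastCases ?_ (fun k => ?_) i
          · simpa using h
          · simpa using hx.prop.mem_of_wit_mem s' G' h k
  exact hwit ((hx.le_of_ge hz hxz).1 (Set.mem_insert _ _))

/-- The saturated limit given by a maximal witnessed diagram. -/
noncomputable def saturatedLimit {B : Type} {x : Diagram S F (WitnessName.{u, v, w} S F B)}
    (hx : Maximal (IsWitnessed T) x) (hne : x.names.Nonempty) :
    SaturatedLimit.{u, v, max u v w} T where
  index := x.names
  filter := (approxFilter.{u, v, max u v w, max u v w} T x.names x.val).map fun y =>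
    { carrier := y.carrier, isModel := y.isModel, name := fun i => y.name i }
  val φ a := x.val ⟨_, φ, fun i => a i⟩
  index_nonempty := hne.to_subtype
  neBot := have := hx.prop.neBot; map_neBot
  tendsto_val φ a := by
    have h : ⟨_, φ, fun i => (a i : WitnessName.{u, v, w} S F B)⟩ ∈ instancesOver S F x.names :=
      fun i => (a i).2
    exact tendsto_map'_iff.2 (tendsto_eval (p := x.val) h)
  exists_witness s G hG := by
    have h := wit_mem_of_maximal hx (fun k => s k) (fun k => (s k).2) G
      fun G₀ hG₀ ε hε => eventually_map.1 (hG G₀ hG₀ ε hε)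
    refine ⟨⟨_, h⟩, fun g hg => ?_⟩
    rw [← hx.prop.val_wit _ G h g hg]
    congr 3
    exact Fin.comp_snoc Subtype.val _ _

end Diagram

/-- Every ultrafilter on models of `T` with a nonempty tuple has a saturated limit. -/
theorem exists_saturatedLimit {S : ContSignature.{u, v}} {F : ConnectiveSystem}
    {T : ContTheory S F} {n : ℕ} (hn : 0 < n)
    (l : Ultrafilter (NamedModel.{u, v, max u v w, 0} T (Fin n))) :
    ∃ (L : SaturatedLimit.{u, v, max u v w} T) (a : Fin n → L.index),
      ∀ φ : ContFormula S F n, Tendsto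
        (fun x : NamedModel.{u, v, max u v w, 0} T (Fin n) => φ.value x.name) l (𝓝 (L.val φ a)) := by
  let e : NamedModel.{u, v, max u v w, 0} T (Fin n) →
      NamedModel.{u, v, max u v w, max u v w} T (WitnessName.{u, v, w} S F (Fin n)) := fun x =>
    { carrier := x.carrier
      isModel := x.isModel
      name := fun i => match i with
        | .base k => x.name k
        -- The images of witness names are irrelevant: the starting diagram uses only base names.
        -- Here `0 < n` provides an element.
        | .wit _ _ => x.name ⟨0, hn⟩ }
  choose p hp using fun P => (l.map e).exists_tendsto fun y => y.eval P
  let x₀ : Diagram S F (WitnessName.{u, v, w} S F (Fin n)) := ⟨Set.range .base, p⟩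
  have hx₀ : x₀.IsWitnessed T :=
    ⟨(l.map e).neBot.mono (le_approxFilter_iff.2 fun P _ => hp P),
      fun _ _ ⟨_, h⟩ => (nomatch h), fun _ _ ⟨_, h⟩ => (nomatch h)⟩
  obtain ⟨x, hx₀x, hx⟩ := zorn_le_nonempty₀ {x | Diagram.IsWitnessed T x}
    (fun c hc hchain y hy => by
      obtain ⟨z, hz, hle⟩ := Diagram.IsWitnessed.exists_upper_bound hc hchain ⟨y, hy⟩
      exact ⟨z, hz, hle⟩) x₀ hx₀
  refine ⟨Diagram.saturatedLimit hx ⟨_, hx₀x.1 ⟨⟨0, hn⟩, rfl⟩⟩,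
    fun k => ⟨.base k, hx₀x.1 ⟨k, rfl⟩⟩, fun φ => ?_⟩
  have h := hx₀x.2 ⟨n, φ, .base⟩ fun i => ⟨i, rfl⟩
  change Tendsto _ _ (𝓝 (x.val ⟨n, φ, .base⟩))
  rw [← h]
  exact hp ⟨n, φ, .base⟩

/-- This is McShane's extension: the infimum over `x` of `g x + δ⁻¹ * dist v (f x)` is Lipschitz in
`v`. At `v = f x`, points within `δ` contribute more than `g x - ε` by hypothesis, and farther ones
pay a penalty of at least 1, which already bounds `g x`. -/
theorem exists_continuousMap_near {X : Type t} {k : ℕ} (f : X → Fin k → unitInterval)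
    (g : X → unitInterval) {δ ε : ℝ} (hδ : 0 < δ)
    (h : ∀ x y, dist (f x) (f y) < δ → dist (g x) (g y) < ε) :
    ∃ c : C(Fin k → unitInterval, unitInterval), ∀ x, dist (c (f x)) (g x) ≤ ε := by
  rcases isEmpty_or_nonempty X with hX | hX
  · exact ⟨ContinuousMap.const _ 0, fun x => hX.elim x⟩
  let e : (Fin k → unitInterval) → X → ℝ := fun v x => g x + δ⁻¹ * dist v (f x)
  have he : ∀ v x, 0 ≤ e v x := fun v x => add_nonneg (g x).2.1 (by positivity)
  have hbdd : ∀ v, BddBelow (Set.range (e v)) := fun v => ⟨0, by rintro _ ⟨x, rfl⟩; exact he v x⟩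
  have hlip : LipschitzWith (Real.toNNReal δ⁻¹) fun v => ⨅ x, e v x := by
    refine LipschitzWith.of_le_add_mul _ fun v w => ?_
    rw [Real.coe_toNNReal _ (by positivity), ← sub_le_iff_le_add]
    refine le_ciInf fun x => ?_
    have h1 := ciInf_le (hbdd v) x
    have h2 := mul_le_mul_of_nonneg_left (dist_triangle v w (f x)) (inv_pos.2 hδ).le
    simp only [e] at h1 ⊢
    linarith
  refine ⟨⟨fun v => Set.projIcc 0 1 zero_le_one (⨅ x, e v x),
    continuous_projIcc.comp hlip.continuous⟩, fun x => ?_⟩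
  have hε : 0 < ε := by simpa using h x x (by simpa using hδ)
  have h0 : 0 ≤ ⨅ z, e (f x) z := le_ciInf (he _)
  have h1 : ⨅ z, e (f x) z ≤ g x := (ciInf_le (hbdd _) x).trans (by simp [e])
  have h2 : g x - ε ≤ ⨅ z, e (f x) z := by
    refine le_ciInf fun z => ?_
    by_cases hz : dist (f x) (f z) < δ
    · have h3 := (le_abs_self _).trans_lt (h x z hz)
      have h4 : 0 ≤ δ⁻¹ * dist (f x) (f z) := by positivity
      simp only [e]
      linarith
    · have h3 : 1 ≤ δ⁻¹ * dist (f x) (f z) := by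
        rw [← inv_mul_cancel₀ hδ.ne']
        exact mul_le_mul_of_nonneg_left (not_lt.1 hz) (inv_pos.2 hδ).le
      have h4 := (g x).2.2
      have h5 := (g z).2.1
      simp only [e]
      linarith
  rw [Subtype.dist_eq, ContinuousMap.coe_mk,
    Set.projIcc_of_mem zero_le_one (⟨h0, h1.trans (g x).2.2⟩ : _ ∈ Set.Icc (0 : ℝ) 1),
    Real.dist_eq, abs_le]
  constructor <;> linarith

/-! ### The two implications -/

section QuantifierElimination

variable {S : ContSignature.{u, v}} {F : ConnectiveSystem} {T : ContTheory S F}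

theorem ContFormula.isQF_relabel {n m : ℕ} (g : Fin n → Fin m) {φ : ContFormula S F n}
    (hφ : φ.IsQF) : (φ.relabel g).IsQF := by
  induction φ generalizing m with
  | atomic P t => trivial
  | conn c φ ih => exact fun i => ih i g (hφ i)
  | inf φ ih => exact hφ.elim
  | sup φ ih => exact hφ.elim

theorem ContTheory.HasQE.sameType {M N : Type (max u v w)} [ContStructure S M]
    [ContStructure S N] (hT : ContTheory.HasQE.{u, v, w} T) (hM : T.IsModel M)
    (hN : T.IsModel N) {n : ℕ} (hn : 0 < n) {a : Fin n → M} {b : Fin n → N}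
    (hab : SameQFType (S := S) F a b) : SameType (S := S) F a b := by
  intro φ
  have key : ∀ ε : ℝ, 0 < ε → dist (φ.value a) (φ.value b) ≤ ε := by
    intro ε hε
    obtain ⟨ψ, hψ, h⟩ := hT n φ (ε / 2) (half_pos hε)
    let g : Fin (max n 1) → Fin n := Fin.cast (max_eq_left hn)
    have h1 := h M hM (a ∘ g)
    have h2 := h N hN (b ∘ g)
    rw [← ContFormula.value_relabel] at h1 h2
    rw [← hab _ (ContFormula.isQF_relabel g hψ), abs_sub_comm] at h2
    have h3 := abs_sub_le (φ.value a : ℝ) ((ψ.relabel g).value a) (φ.value b)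
    exact h3.trans ((add_le_add h1 h2).trans_eq (add_halves ε))
  exact dist_le_zero.1 (le_of_forall_pos_le_add fun ε hε => by simpa using key ε hε)

/-- At a quantifier, each element of either model is matched by an element of the other that
preserves the quantifier-free type of the longer tuple, so both sides take the infimum or supremum
of the same values. -/
theorem ContTheory.HasBackAndForth.value_eq {M N : Type (max u v w)} [ContStructure S M]
    [ContStructure S N] (hT : ContTheory.HasBackAndForth.{u, v, w} T)
    (hMs : IsOmegaSaturated.{u, v, w} S F M) (hNs : IsOmegaSaturated.{u, v, w} S F N)
    (hM : T.IsModel M) (hN : T.IsModel N) {n : ℕ} (hn : 0 < n) {a : Fin n → M} {b : Fin n → N}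
    (hab : SameQFType (S := S) F a b) (φ : ContFormula S F n) : φ.value a = φ.value b := by
  induction φ with
  | atomic P t => exact hab _ trivial
  | conn c φ ih =>
    simp only [ContFormula.value]
    congr 1
    funext i
    exact ih i hn hab
  | inf φ ih =>
    refine le_antisymm (le_iInf fun d => ?_) (le_iInf fun c => ?_)
    · obtain ⟨c, hc⟩ := hT N M hNs hMs hN hM _ hn b a d fun φ hφ => (hab φ hφ).symm
      exact iInf_le_of_le c (ih (Nat.succ_pos _) fun φ hφ => (hc φ hφ).symm).le
    · obtain ⟨d, hd⟩ := hT M N hMs hNs hM hN _ hn a b c hab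
      exact iInf_le_of_le d (ih (Nat.succ_pos _) hd).ge
  | sup φ ih =>
    refine le_antisymm (iSup_le fun c => ?_) (iSup_le fun d => ?_)
    · obtain ⟨d, hd⟩ := hT M N hMs hNs hM hN _ hn a b c hab
      exact le_iSup_of_le d (ih (Nat.succ_pos _) hd).le
    · obtain ⟨c, hc⟩ := hT N M hNs hMs hN hM _ hn b a d fun φ hφ => (hab φ hφ).symm
      exact le_iSup_of_le c (ih (Nat.succ_pos _) fun φ hφ => (hc φ hφ).symm).ge

/-- Under the back-and-forth property, the value of a formula is uniformly controlled by the
values of finitely many quantifier-free formulae. -/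
theorem ContTheory.HasBackAndForth.exists_finset (hF : F.IsFull)
    (hT : ContTheory.HasBackAndForth.{u, v, w} T) {n : ℕ} (hn : 0 < n) (φ : ContFormula S F n)
    {ε : ℝ} (hε : 0 < ε) :
    ∃ (K : Finset {ψ : ContFormula S F n // ψ.IsQF}) (δ : ℝ), 0 < δ ∧
      ∀ x y : NamedModel.{u, v, max u v w, 0} T (Fin n),
        (∀ ψ ∈ K, dist (ψ.1.value x.name) (ψ.1.value y.name) < δ) →
          dist (φ.value x.name) (φ.value y.name) < ε := by
  classical
  by_contra! hcon
  choose x y hxy hφ using fun κ : Finset {ψ : ContFormula S F n // ψ.IsQF} × ℕ =>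
    hcon κ.1 (1 / ((κ.2 : ℝ) + 1)) (by positivity)
  -- Along this ultrafilter every quantifier-free formula eventually belongs to the finite set, and
  -- the tolerance tends to 0.
  let l := Ultrafilter.of (atTop : Filter (Finset {ψ : ContFormula S F n // ψ.IsQF} × ℕ))
  obtain ⟨L, a, hL⟩ := exists_saturatedLimit hn (l.map x)
  obtain ⟨L', a', hL'⟩ := exists_saturatedLimit hn (l.map y)
  have hdist : ∀ ψ : ContFormula S F n,
      Tendsto (fun κ => dist (ψ.value (x κ).name) (ψ.value (y κ).name)) l
        (𝓝 (dist (ψ.value (L.toCarrier ∘ a)) (ψ.value (L'.toCarrier ∘ a')))) := fun ψ => by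
    rw [L.value_toCarrier, L'.value_toCarrier]
    exact Tendsto.dist (hL ψ) (hL' ψ)
  have hqf : SameQFType (S := S) F (L.toCarrier ∘ a) (L'.toCarrier ∘ a') := by
    intro ψ hψ
    refine dist_le_zero.1 (le_of_tendsto_of_tendsto
      (g := fun κ => 1 / ((κ.2 : ℝ) + 1)) (hdist ψ)
      (Tendsto.mono_left ?_ (Ultrafilter.of_le _)) ?_)
    · rw [← prod_atTop_atTop_eq]
      exact tendsto_one_div_add_atTop_nhds_zero_nat.comp tendsto_snd
    · refine Ultrafilter.of_le _ ((eventually_ge_atTop ({⟨ψ, hψ⟩}, 0)).mono fun κ hκ => ?_)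
      exact (hxy κ ⟨ψ, hψ⟩ (hκ.1 (Finset.mem_singleton_self _))).le
  have heq := hT.value_eq (L.isOmegaSaturated hF) (L'.isOmegaSaturated hF) L.isModel L'.isModel
    hn hqf φ
  -- The gap of at least `ε` persists in the limit, where both values of `φ` agree.
  have := ge_of_tendsto' (hdist φ) hφ
  rw [heq, dist_self] at this
  exact this.not_gt hε

theorem ContTheory.HasBackAndForth.hasQE (hF : F.IsFull)
    (hT : ContTheory.HasBackAndForth.{u, v, w} T) : ContTheory.HasQE.{u, v, w} T := by
  classical
  intro n φ ε hε
  have hm : 0 < max n 1 := lt_max_of_lt_right one_pos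
  obtain ⟨K, δ, hδ, hK⟩ := hT.exists_finset hF hm (φ.relabel (Fin.castLE (le_max_left n 1)))
    (half_pos hε)
  -- Fullness needs a positive number of formulae. The formula `d(x₀, x₀)` exists in every signature
  -- but has a free variable, so a sentence is allowed one.
  let χ : {ψ : ContFormula S F (max n 1) // ψ.IsQF} :=
    ⟨.atomic S.distSymb fun _ => .var ⟨0, hm⟩, trivial⟩
  let K' := insert χ K
  let ψ : Fin K'.card → {ψ : ContFormula S F (max n 1) // ψ.IsQF} := fun i => K'.equivFin.symm i
  obtain ⟨c, hc⟩ := exists_continuousMap_near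
    (fun (x : NamedModel.{u, v, max u v w, 0} T (Fin (max n 1))) i => (ψ i).1.value x.name)
    (fun x => (φ.relabel (Fin.castLE (le_max_left n 1))).value x.name) hδ fun x y hxy => by
      refine hK x y fun θ hθ => lt_of_le_of_lt ?_ hxy
      have h1 : ψ (K'.equivFin ⟨θ, Finset.mem_insert_of_mem hθ⟩) = θ := by simp [ψ]
      have h2 := dist_le_pi_dist (fun i => (ψ i).1.value x.name)
        (fun i => (ψ i).1.value y.name) (K'.equivFin ⟨θ, Finset.mem_insert_of_mem hθ⟩)
      simpa only [h1] using h2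
  obtain ⟨θ, hθ, hval⟩ := ContFormula.exists_value_near.{u, v, max u v w} hF
    (Finset.card_pos.2 (Finset.insert_nonempty χ K)) c (half_pos hε) fun i => (ψ i).1
  refine ⟨θ, hθ fun i => (ψ i).2, fun M _ hM a => ?_⟩
  have h1 := hc ⟨M, hM, a⟩
  have h2 := hval M a
  simp only [ContFormula.value_relabel] at h1
  have h3 := dist_triangle_left (φ.value (a ∘ Fin.castLE (le_max_left n 1))) (θ.value a)
    (c fun i => (ψ i).1.value a)
  rw [dist_comm (θ.value a)] at h2
  exact h3.trans ((add_le_add h1 h2.le).trans_eq (add_halves ε))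

end QuantifierElimination

theorem mainTheorem9 (S : ContSignature.{u, v}) (F : ConnectiveSystem) (hF : F.IsFull)
    (T : ContTheory S F) :
    ContTheory.HasQE.{u, v, w} T ↔ ContTheory.HasBackAndForth.{u, v, w} T :=
  ⟨fun hT M N _ _ _ hNs hM hN n hn a b c hab => by
    obtain ⟨d, hd⟩ := hNs n b M a (fun φ => (hT.sameType hM hN hn hab φ).symm) c
    exact ⟨d, fun φ _ => (hd φ).symm⟩, fun hT => hT.hasQE hF⟩
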